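/- Let $n$ be a natural number and let $\mathcal G_1,\dots,\mathcal G_n$ be principal, second-countable, locally compact, Hausdorff, étale topological groupoids whose unit spaces $\mathcal G_i^{(0)}$ are compact and zero-dimensional (the clopen sets form a basis). Here $r$ and $s$ denote the range and source maps; étale means that $r,s:\mathcal G\to\mathcal G^{(0)}$ are local homeomorphisms, and principal means that every $g\in\mathcal G$ with $r(g)=s(g)$ is a unit. The product $\mathcal G_1\times\dots\times\mathcal G_n$ carries the component-wise operations and the product topology. For a locally compact, Hausdorff, étale groupoid $\mathcal G$, the dynamic asymptotic dimension $\mathrm{dad}(\mathcal G)\in\mathbb N\cup\{\infty\}$ is the smallest $d\in\mathbb N=\{0,1,2,\dots\}$ with the following property, and $\infty$ if there is no such $d$: for every open relatively compact subset $K\subseteq\mathcal G$ there are open subsets $U_0,\dots,U_d\subseteq\mathcal G^{(0)}$ covering $s(K)\cup r(K)$ such that, for each $i\in\{0,\dots,d\}$, the set $\{g\in K: s(g),r(g)\in U_i\}$ is contained in a relatively compact subgroupoid of $\mathcal G$. Suppose that $\mathrm{dad}(\mathcal G_i)\ge 1$ for every $i\in\{1,\dots,n\}$. Then $$\mathrm{dad}(\mathcal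 G_1\times\dots\times\mathcal G_n)\ \ge\ n,$$ and equality holds whenever $\mathrm{dad}(\mathcal G_i)=1$ for every $i\in\{1,\dots,n\}$. -/

import Mathlib

/-- A groupoid, presented by its set `G` of arrows: the units are the arrows `u` with
`src u = u`, range and source are maps `G → G` onto the units, and the product `comp g h` is
defined for composable pairs, i.e. those with `src g = rng h`. -/
class ArrowGroupoid (G : Type*) where
  /-- the source map -/
  src : G → G
  /-- the range map -/
  rng : G → G
  /-- the inverse -/
  inv : G → G
  /-- the product of a composable pair -/
  comp : ∀ g h : G, src g = rng h → G
  src_src : ∀ g, src (src g) = src g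
  rng_src : ∀ g, rng (src g) = src g
  src_rng : ∀ g, src (rng g) = rng g
  rng_rng : ∀ g, rng (rng g) = rng g
  src_inv : ∀ g, src (inv g) = rng g
  rng_inv : ∀ g, rng (inv g) = src g
  src_comp : ∀ g h hgh, src (comp g h hgh) = src h
  rng_comp : ∀ g h hgh, rng (comp g h hgh) = rng g
  comp_assoc : ∀ g h k (hgh : src g = rng h) (hhk : src h = rng k),
    comp (comp g h hgh) k ((src_comp g h hgh).trans hhk) =
      comp g (comp h k hhk) (hgh.trans (rng_comp h k hhk).symm)
  rng_mul : ∀ g, comp (rng g) g (src_rng g) = g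
  mul_src : ∀ g, comp g (src g) (rng_src g).symm = g
  mul_inv : ∀ g, comp g (inv g) (rng_inv g).symm = rng g
  inv_mul : ∀ g, comp (inv g) g (src_inv g) = src g

namespace ArrowGroupoid

/-- The unit space `G⁽⁰⁾`, as a subset of `G`. -/
def units (G : Type*) [ArrowGroupoid G] : Set G := {u | src u = u}

/-- The source map as a map onto the unit space. -/
def srcMap {G : Type*} [ArrowGroupoid G] (g : G) : units G := ⟨src g, src_src g⟩

/-- The range map as a map onto the unit space. -/
def rngMap {G : Type*} [ArrowGroupoid G] (g : G) : units G := ⟨rng g, src_rng g⟩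

/-- A groupoid is principal if every arrow with equal source and range is a unit. -/
def IsPrincipal (G : Type*) [ArrowGroupoid G] : Prop :=
  ∀ g : G, rng g = src g → g ∈ units G

/-- A subgroupoid (not necessarily with the same units) is a subset that is closed under inverses
and under products of composable pairs; it then contains the source and range of its elements. -/
structure IsSubgroupoid {G : Type*} [ArrowGroupoid G] (H : Set G) : Prop where
  inv_mem : ∀ g ∈ H, inv g ∈ H
  comp_mem : ∀ g ∈ H, ∀ h ∈ H, ∀ hgh : src g = rng h, comp g h hgh ∈ H

/-- The product of a family of groupoids, with componentwise operations. -/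
instance instPi {ι : Type*} (G : ι → Type*) [∀ i, ArrowGroupoid (G i)] :
    ArrowGroupoid (∀ i, G i) where
  src g i := src (g i)
  rng g i := rng (g i)
  inv g i := inv (g i)
  comp g h hgh i := comp (g i) (h i) (congrFun hgh i)
  src_src g := funext fun i => src_src (g i)
  rng_src g := funext fun i => rng_src (g i)
  src_rng g := funext fun i => src_rng (g i)
  rng_rng g := funext fun i => rng_rng (g i)
  src_inv g := funext fun i => src_inv (g i)
  rng_inv g := funext fun i => rng_inv (g i)
  src_comp g h hgh := funext fun i => src_comp (g i) (h i) (congrFun hgh i)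
  rng_comp g h hgh := funext fun i => rng_comp (g i) (h i) (congrFun hgh i)
  comp_assoc g h k hgh hhk :=
    funext fun i => comp_assoc (g i) (h i) (k i) (congrFun hgh i) (congrFun hhk i)
  rng_mul g := funext fun i => rng_mul (g i)
  mul_src g := funext fun i => mul_src (g i)
  mul_inv g := funext fun i => mul_inv (g i)
  inv_mul g := funext fun i => inv_mul (g i)

/-- A topological groupoid: inversion is continuous on `G` and the product is continuous on the
space of composable pairs. Continuity of source and range follows. -/
class IsTopologicalGroupoid (G : Type*) [TopologicalSpace G] [ArrowGroupoid G] : Prop where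
  continuous_inv : Continuous (inv : G → G)
  continuous_comp :
    Continuous fun p : {p : G × G // src p.1 = rng p.2} => comp p.1.1 p.1.2 p.2

/-- Products of topological groupoids, with the product topology, are topological groupoids. -/
instance instPiTopological {ι : Type*} (G : ι → Type*) [∀ i, TopologicalSpace (G i)]
    [∀ i, ArrowGroupoid (G i)] [∀ i, IsTopologicalGroupoid (G i)] :
    IsTopologicalGroupoid (∀ i, G i) where
  continuous_inv := continuous_pi fun i =>
    IsTopologicalGroupoid.continuous_inv.comp (continuous_apply i)
  continuous_comp := continuous_pi fun i =>
    (IsTopologicalGroupoid.continuous_comp (G := G i)).comp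
      (f := fun p : {p : (∀ i, G i) × (∀ i, G i) // src p.1 = rng p.2} =>
        (⟨(p.1.1 i, p.1.2 i), congrFun p.2 i⟩ :
          {q : G i × G i // src q.1 = rng q.2})) (by fun_prop)

/-- A topological groupoid is étale if range and source are local homeomorphisms onto the unit
space, which carries the subspace topology. -/
structure IsEtale (G : Type*) [TopologicalSpace G] [ArrowGroupoid G] : Prop where
  rng_isLocalHomeomorph : IsLocalHomeomorph (rngMap : G → units G)
  src_isLocalHomeomorph : IsLocalHomeomorph (srcMap : G → units G)

/-- The defining property of dynamic asymptotic dimension at most `d`. -/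
def HasDadAtMost (G : Type*) [TopologicalSpace G] [ArrowGroupoid G] (d : ℕ) : Prop :=
  ∀ K : Set G, IsOpen K → IsCompact (closure K) →
    ∃ U : Fin (d + 1) → Set (units G),
      (∀ i, IsOpen (U i)) ∧
      srcMap '' K ∪ rngMap '' K ⊆ (⋃ i, U i) ∧
      ∀ i, ∃ H : Set G, IsSubgroupoid H ∧ IsCompact (closure H) ∧
        {g ∈ K | srcMap g ∈ U i ∧ rngMap g ∈ U i} ⊆ H

/-- The dynamic asymptotic dimension: the smallest `d` with the above property, and `⊤` if there
is no such `d`. -/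
noncomputable def dad (G : Type*) [TopologicalSpace G] [ArrowGroupoid G] : ℕ∞ :=
  ⨅ (d : ℕ) (_ : HasDadAtMost G d), (d : ℕ∞)

end ArrowGroupoid

/-! Lower bound. A factor of positive dimension has a symmetric relatively compact open set `K i`
that contains the units and generates a subgroupoid which is not relatively compact
(`exists_generating`). If the product had dimension at most d < n, the product of the `K i` would
give d + 1 ≤ n colours of units, each with a relatively compact subgroupoid `H j`. For each i pick a
product of elements of `K i` outside the i-th projections of all closures of the `H j`. Its partial
products form a path, and the n paths span a lattice in the product groupoid. Colour a lattice point
by its source. By the Hex theorem (`hex`), which follows from a mod 2 Sperner lemma, some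
monochromatic chain crosses the lattice in the direction i matching its colour. The quotients of
successive points lie in one `H j`, hence so does their product, whose i-th component is the
excluded arrow.

Upper bound. This is the Kolmogorov–Ostrand trick: in dimension at most 1 there are, at every scale,
n + 1 controlled clopen sets such that each unit is missed by at most one of them
(`exists_clopen_family`). In the product take boxes of sets with equal index. The n coordinates
spoil at most n of the n + 1 indices, so the boxes cover. -/

/-! ### A cubical Sperner lemma and the Hex theorem -/

namespace CubicalSperner

variable {α : Type*}

/-- The mod 2 coboundary of a function on lists. -/
def coboundary : (List α → ZMod 2) → List α → ZMod 2
  | _, [] => 0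
  | F, a :: l => F l + coboundary (fun m => F (a :: m)) l

/-- The mod 2 prism operator between the maps `u` and `v`, acting on functions on lists. -/
def prism (u v : α → α) : (List α → ZMod 2) → List α → ZMod 2
  | _, [] => 0
  | F, a :: l => F (u a :: v a :: l.map v) + prism u v (fun m => F (u a :: m)) l

theorem coboundary_add (F F' : List α → ZMod 2) (l : List α) :
    coboundary (fun m => F m + F' m) l = coboundary F l + coboundary F' l := by
  induction l generalizing F F' with
  | nil => simp [coboundary]
  | cons a l ih => simp only [coboundary, ih]; ring

theorem coboundary_zero (l : List α) : coboundary (fun _ => 0) l = 0 := by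
  induction l with
  | nil => rfl
  | cons a l ih => simp only [coboundary, ih, add_zero]

theorem coboundary_sum {ι : Type*} (s : Finset ι) (F : ι → List α → ZMod 2) (l : List α) :
    coboundary (fun m => ∑ t ∈ s, F t m) l = ∑ t ∈ s, coboundary (F t) l := by
  classical
  induction s using Finset.induction_on with
  | empty => simp [coboundary_zero]
  | insert a s ha ih => simp only [Finset.sum_insert ha, coboundary_add, ih]

theorem coboundary_map (v : α → α) (F : List α → ZMod 2) (l : List α) :
    coboundary (fun m => F (m.map v)) l = coboundary F (l.map v) := by
  induction l generalizing F with
  | nil => rfl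
  | cons a l ih =>
    simp only [coboundary, List.map_cons]
    rw [ih (fun m => F (v a :: m))]

theorem prism_add (u v : α → α) (F F' : List α → ZMod 2) (l : List α) :
    prism u v (fun m => F m + F' m) l = prism u v F l + prism u v F' l := by
  induction l generalizing F F' with
  | nil => simp [prism]
  | cons a l ih => simp only [prism, ih]; ring

/-- The prism operator is a homotopy between the two ends of the prism. -/
theorem prism_coboundary (u v : α → α) (F : List α → ZMod 2) (l : List α) :
    prism u v (coboundary F) l =
      F (l.map v) + F (l.map u) + coboundary (prism u v F) l := by
  induction l generalizing F with
  | nil => simp [prism, coboundary, CharTwo.add_self_eq_zero]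
  | cons a l ih =>
    simp only [prism, coboundary, List.map_cons, prism_add, coboundary_add, ih]
    rw [coboundary_map v (fun m => F (u a :: v a :: m))]
    -- This face is shared by two consecutive simplices of the prism, so it cancels mod 2.
    linear_combination (CharTwo.add_self_eq_zero (F (u a :: l.map v)))

/-- Unfolding the recursion, the prism operator sums `F` over all cut points of `l`, so a nonzero
sum has a nonzero term. -/
theorem exists_of_prism_ne_zero {u v : α → α} {F : List α → ZMod 2} {l : List α}
    (h : prism u v F l ≠ 0) :
    ∃ l₁ a l₂, l = l₁ ++ a :: l₂ ∧ F (l₁.map u ++ u a :: v a :: l₂.map v) ≠ 0 := by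
  induction l generalizing F with
  | nil => exact absurd rfl h
  | cons a l ih =>
    by_cases h1 : F (u a :: v a :: l.map v) = 0
    · simp only [prism, h1, zero_add] at h
      obtain ⟨l₁, b, l₂, rfl, h2⟩ := ih h
      exact ⟨a :: l₁, b, l₂, rfl, h2⟩
    · exact ⟨[], a, l, rfl, h1⟩

/-- The prism in the direction of the `n`-th coordinate over the interval `[0, N]`. -/
def boxPrism (N n : ℕ) (F : List (ℕ → ℕ) → ZMod 2) (l : List (ℕ → ℕ)) : ZMod 2 :=
  ∑ t ∈ Finset.range N,
    prism (fun a => Function.update a n t) (fun a => Function.update a n (t + 1)) F l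

/-- Evaluation on the fundamental chain of the box `[0, N] ^ n`. -/
def boxEval (N : ℕ) : ℕ → (List (ℕ → ℕ) → ZMod 2) → ZMod 2
  | 0, F => F [0]
  | n + 1, F => boxEval N n (boxPrism N n F)

theorem boxPrism_add (N n : ℕ) (F F' : List (ℕ → ℕ) → ZMod 2) (l : List (ℕ → ℕ)) :
    boxPrism N n (fun m => F m + F' m) l = boxPrism N n F l + boxPrism N n F' l := by
  simp only [boxPrism, prism_add, Finset.sum_add_distrib]

theorem boxEval_add (N n : ℕ) (F F' : List (ℕ → ℕ) → ZMod 2) :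
    boxEval N n (fun m => F m + F' m) = boxEval N n F + boxEval N n F' := by
  induction n generalizing F F' with
  | zero => rfl
  | succ n ih =>
    simp only [boxEval]
    rw [← ih]
    congr 1
    exact funext fun l => boxPrism_add N n F F' l

/-- The ends of the prisms over consecutive intervals telescope, leaving only the ends at 0 and `N`.
-/
theorem boxPrism_coboundary (N n : ℕ) (F : List (ℕ → ℕ) → ZMod 2) (l : List (ℕ → ℕ)) :
    boxPrism N n (coboundary F) l =
      (F (l.map fun a => Function.update a n N) + F (l.map fun a => Function.update a n 0)) +
        coboundary (boxPrism N n F) l := by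
  have h := coboundary_sum (Finset.range N) (fun t => prism (fun a => Function.update a n t)
    (fun a => Function.update a n (t + 1)) F) l
  have h' : coboundary (boxPrism N n F) l = _ := h
  rw [h']
  simp only [boxPrism, prism_coboundary, Finset.sum_add_distrib]
  congr 1
  rw [← Finset.sum_add_distrib]
  have := Finset.sum_range_sub (fun t => F (l.map fun a => Function.update a n t)) N
  simpa only [CharTwo.sub_eq_add] using this

theorem boxEval_coboundary_succ (N n : ℕ) (F : List (ℕ → ℕ) → ZMod 2) :
    boxEval N (n + 1) (coboundary F) =
      boxEval N n (fun l => F (l.map fun a => Function.update a n N)) +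
      boxEval N n (fun l => F (l.map fun a => Function.update a n 0)) +
      boxEval N n (coboundary (boxPrism N n F)) := by
  rw [← boxEval_add, ← boxEval_add]
  simp only [boxEval]
  congr 1
  exact funext fun l => boxPrism_coboundary N n F l

theorem boxEval_zero (N n : ℕ) : boxEval N n (fun _ => 0) = 0 := by
  have := boxEval_add N n (fun _ => 0) (fun _ => 0)
  simpa using this

/-- Two lattice points are adjacent if all their coordinates differ by at most one. -/
def Adj {ι : Type*} (x y : ι → ℕ) : Prop := ∀ i, x i ≤ y i + 1 ∧ y i ≤ x i + 1

theorem adj_update {x y : ℕ → ℕ} (h : Adj x y) (n t s : ℕ) (h1 : t ≤ s + 1) (h2 : s ≤ t + 1) :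
    Adj (Function.update x n t) (Function.update y n s) := by
  intro i
  by_cases hi : i = n
  · subst hi; simp [h1, h2]
  · simpa [hi] using h i

/-- Simplices of the triangulated box `[0, N] ^ n`: pairwise adjacent points with vanishing
coordinates from the `n`-th on. -/
def IsCell (n : ℕ) (l : List (ℕ → ℕ)) : Prop :=
  l.length = n + 1 ∧ (∀ x ∈ l, ∀ y ∈ l, Adj x y) ∧ ∀ x ∈ l, ∀ i, n ≤ i → x i = 0

theorem exists_cell_of_boxEval_ne_zero {N n : ℕ} {F : List (ℕ → ℕ) → ZMod 2}
    (h : boxEval N n F ≠ 0) : ∃ l, IsCell n l ∧ F l ≠ 0 := by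
  induction n generalizing F with
  | zero => exact ⟨[0], ⟨rfl, by simp [Adj], by simp⟩, h⟩
  | succ n ih =>
    obtain ⟨l, ⟨hl, hadj, h0⟩, hF⟩ := ih h
    obtain ⟨t, -, ht⟩ := Finset.exists_ne_zero_of_sum_ne_zero hF
    obtain ⟨l₁, a, l₂, rfl, hne⟩ := exists_of_prism_ne_zero ht
    refine ⟨_, ⟨?_, ?_, ?_⟩, hne⟩
    · simp at hl ⊢; omega
    -- Every vertex of a prism simplex is a base vertex with last coordinate `t` or `t + 1`, so
    -- adjacency is inherited from the base.
    · have key : ∀ z ∈ List.map (fun a => Function.update a n t) l₁ ++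
          Function.update a n t :: Function.update a n (t + 1) ::
            List.map (fun a => Function.update a n (t + 1)) l₂,
          ∃ b ∈ l₁ ++ a :: l₂, ∃ s, t ≤ s ∧ s ≤ t + 1 ∧ z = Function.update b n s := by
        intro z hz
        simp only [List.mem_append, List.mem_map, List.mem_cons] at hz
        rcases hz with ⟨b, hb, rfl⟩ | rfl | rfl | ⟨b, hb, rfl⟩
        · exact ⟨b, by simp [hb], t, by omega, by omega, rfl⟩
        · exact ⟨a, by simp, t, by omega, by omega, rfl⟩
        · exact ⟨a, by simp, t + 1, by omega, by omega, rfl⟩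
        · exact ⟨b, by simp [hb], t + 1, by omega, by omega, rfl⟩
      intro x hx y hy
      obtain ⟨b, hb, s, h1, h2, rfl⟩ := key x hx
      obtain ⟨b', hb', s', h1', h2', rfl⟩ := key y hy
      exact adj_update (hadj b hb b' hb') _ _ _ (by omega) (by omega)
    · intro x hx i hi
      have hin : i ≠ n := by omega
      simp only [List.mem_append, List.mem_map, List.mem_cons] at hx
      rcases hx with ⟨b, hb, rfl⟩ | rfl | rfl | ⟨b, hb, rfl⟩ <;>
        simp only [Function.update_of_ne hin]
      · exact h0 b (by simp [hb]) i (by omega)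
      · exact h0 a (by simp) i (by omega)
      · exact h0 a (by simp) i (by omega)
      · exact h0 b (by simp [hb]) i (by omega)

theorem boxEval_congr {N n : ℕ} {F F' : List (ℕ → ℕ) → ZMod 2}
    (h : ∀ l, IsCell n l → F l = F' l) : boxEval N n F = boxEval N n F' := by
  by_contra hne
  have h1 : boxEval N n (fun l => F l + F' l) ≠ 0 := by
    rw [boxEval_add]
    intro h0
    exact hne (CharTwo.add_eq_zero.mp h0)
  obtain ⟨l, hl, hne'⟩ := exists_cell_of_boxEval_ne_zero h1
  exact hne' (by rw [h l hl, CharTwo.add_self_eq_zero])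

/-- A prism in direction `n` leaves the coordinate `i < n` unchanged, so it stays in the face `x i =
e`. -/
theorem boxPrism_eq_zero {N n i e : ℕ} (hi : i < n) {F : List (ℕ → ℕ) → ZMod 2}
    (hF : ∀ l : List (ℕ → ℕ), l ≠ [] → (∀ x ∈ l, x i = e) → F l = 0) {l : List (ℕ → ℕ)}
    (hl : ∀ x ∈ l, x i = e) : boxPrism N n F l = 0 := by
  by_contra hne
  obtain ⟨t, -, ht⟩ := Finset.exists_ne_zero_of_sum_ne_zero hne
  obtain ⟨l₁, a, l₂, rfl, hne'⟩ := exists_of_prism_ne_zero ht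
  refine hne' (hF _ (by simp) fun x hx => ?_)
  have hin : i ≠ n := by omega
  simp only [List.mem_append, List.mem_map, List.mem_cons] at hx
  rcases hx with ⟨b, hb, rfl⟩ | rfl | rfl | ⟨b, hb, rfl⟩ <;>
    simp only [Function.update_of_ne hin]
  · exact hl b (by simp [hb])
  · exact hl a (by simp)
  · exact hl a (by simp)
  · exact hl b (by simp [hb])

/-- Stokes' theorem mod 2. The empty list lies vacuously in every face, hence the separate
hypothesis `h0`; it settles `n = 0`, where the coboundary at a point is `F []`. -/
theorem boxEval_coboundary_eq_zero (N n : ℕ) (F : List (ℕ → ℕ) → ZMod 2)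
    (h : ∀ i < n, ∀ e, e = 0 ∨ e = N → ∀ l : List (ℕ → ℕ), l ≠ [] → (∀ x ∈ l, x i = e) → F l = 0)
    (h0 : F [] = 0) :
    boxEval N n (coboundary F) = 0 := by
  induction n generalizing F with
  | zero => simp [boxEval, coboundary, h0]
  | succ n ih =>
    have face : ∀ e, e = 0 ∨ e = N →
        boxEval N n (fun l => F (l.map fun a => Function.update a n e)) = 0 := by
      intro e he
      rw [← boxEval_zero N n]
      refine boxEval_congr fun l hl => ?_
      refine h n (by omega) e he _ ?_ (by simp)
      have := hl.1
      intro h'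
      simp at h'
      simp [h'] at this
    rw [boxEval_coboundary_succ, face N (Or.inr rfl), face 0 (Or.inl rfl), add_zero, zero_add]
    refine ih _ ?_ (by simp [boxPrism, prism])
    exact fun i hi e he l _ hl => boxPrism_eq_zero hi (h i (by omega) e he) hl

open scoped Classical in
/-- The indicator function of the lists whose labels are `0, …, k - 1`. -/
noncomputable def fullLabel (L : α → ℕ) (k : ℕ) (l : List α) : ZMod 2 :=
  if ((l.map L : List ℕ) : Multiset ℕ) = Multiset.range k then 1 else 0

theorem coboundary_multiset (L : α → ℕ) (f : Multiset ℕ → ZMod 2) (l : List α) :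
    coboundary (fun m => f (m.map L : List ℕ)) l =
      (((l.map L : List ℕ) : Multiset ℕ).map fun q =>
        f (((l.map L : List ℕ) : Multiset ℕ).erase q)).sum := by
  induction l generalizing f with
  | nil => simp [coboundary]
  | cons a l ih =>
    have := ih (fun M => f (L a ::ₘ M))
    simp only [coboundary, List.map_cons, ← Multiset.cons_coe] at this ⊢
    rw [this, Multiset.map_cons, Multiset.sum_cons, Multiset.erase_cons_head]
    congr 2
    refine Multiset.map_congr rfl fun q hq => ?_
    by_cases hqa : q = L a
    · subst hqa
      rw [Multiset.erase_cons_head, Multiset.cons_erase hq]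
    · rw [Multiset.erase_cons_tail _ (Ne.symm hqa)]

/-- The parity count behind Sperner's lemma: if deleting `q` leaves `0, …, n - 1`, then exactly the
copies of `q` can be deleted, and there are two of them if `q < n` but one if `q = n`. -/
theorem sum_erase_eq_range (n : ℕ) (M : Multiset ℕ) (hM : ∀ q ∈ M, q ≤ n) :
    (M.map fun q => if M.erase q = Multiset.range n then (1 : ZMod 2) else 0).sum =
      if M = Multiset.range (n + 1) then 1 else 0 := by
  by_cases h : ∃ q ∈ M, M.erase q = Multiset.range n
  · obtain ⟨q, hq, hqn⟩ := h
    have hMq : M = q ::ₘ Multiset.range n := by rw [← hqn, Multiset.cons_erase hq]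
    have h1 : (M.map fun q' => if M.erase q' = Multiset.range n then (1 : ZMod 2) else 0) =
        M.map fun q' => if q = q' then (1 : ZMod 2) else 0 := by
      refine Multiset.map_congr rfl fun q' hq' => if_congr ?_ rfl rfl
      constructor
      · intro h'
        have : M = q' ::ₘ Multiset.range n := by rw [← h', Multiset.cons_erase hq']
        rw [hMq] at this
        exact Multiset.cons_inj_left _ |>.mp this
      · rintro rfl; exact hqn
    have h2 : ∀ M' : Multiset ℕ, (M'.map fun q' => if q = q' then (1 : ZMod 2) else 0).sum =
        (M'.count q : ZMod 2) := by
      intro M'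
      induction M' using Multiset.induction_on with
      | empty => simp
      | cons a s ih =>
        rw [Multiset.map_cons, Multiset.sum_cons, ih, Multiset.count_cons]
        split_ifs <;> push_cast <;> ring
    rw [h1, h2, hMq, Multiset.count_cons_self]
    rcases (hM q hq).lt_or_eq with hlt | rfl
    · rw [Multiset.count_eq_one_of_mem (Multiset.nodup_range n) (Multiset.mem_range.mpr hlt),
        if_neg]
      · rfl
      · intro h'
        have := Multiset.nodup_range (n + 1)
        rw [← h', Multiset.nodup_cons] at this
        exact this.1 (Multiset.mem_range.mpr hlt)
    · rw [Multiset.count_eq_zero_of_notMem (by simp), if_pos (by rw [Multiset.range_succ])]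
      rfl
  · rw [if_neg]
    · push Not at h
      rw [Multiset.map_congr rfl fun q hq => if_neg (h q hq)]
      simp
    · rintro rfl
      refine h ⟨n, by simp, ?_⟩
      rw [Multiset.range_succ, Multiset.erase_cons_head]

theorem coboundary_fullLabel (L : α → ℕ) (n : ℕ) (l : List α) (hl : ∀ x ∈ l, L x ≤ n) :
    coboundary (fullLabel L n) l = fullLabel L (n + 1) l := by
  classical
  have h := coboundary_multiset L
    (fun M => if M = Multiset.range n then (1 : ZMod 2) else 0) l
  have h' := sum_erase_eq_range n ((l.map L : List ℕ) : Multiset ℕ) (by simpa using hl)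
  rw [h'] at h
  unfold fullLabel
  convert h

theorem fullLabel_eq_zero {L : α → ℕ} {k : ℕ} {l : List α} (p : ℕ) (hp : p < k)
    (h : ∀ x ∈ l, L x ≠ p) : fullLabel L k l = 0 := by
  refine if_neg fun h' => ?_
  have : p ∈ ((l.map L : List ℕ) : Multiset ℕ) := by rw [h']; simpa using hp
  simp only [Multiset.mem_coe, List.mem_map] at this
  obtain ⟨x, hx, hxp⟩ := this
  exact h x hx hxp

/-- The fundamental chain of the box contains an odd number of fully labelled simplices. -/
theorem boxEval_fullLabel (N : ℕ) (L : (ℕ → ℕ) → ℕ) (n : ℕ)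
    (h0 : ∀ x i, x i = 0 → L x ≠ i + 1) (hN : ∀ x, ∀ i < n, x i = N → L x ≠ 0) :
    boxEval N n (fullLabel L (n + 1)) = 1 := by
  induction n with
  | zero =>
    refine if_pos ?_
    have : L 0 = 0 := by
      by_contra h
      obtain ⟨i, hi⟩ := Nat.exists_eq_succ_of_ne_zero h
      exact h0 0 i rfl hi
    simp [this, Multiset.range_succ]
  | succ n ih =>
    have hco : boxEval N (n + 1) (fullLabel L (n + 1 + 1)) =
        boxEval N (n + 1) (coboundary (fullLabel L (n + 1))) := by
      refine boxEval_congr fun l hl => (coboundary_fullLabel L (n + 1) l fun x hx => ?_).symm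
      by_contra hlt
      obtain ⟨i, hi⟩ := Nat.exists_eq_succ_of_ne_zero (n := L x) (by omega)
      exact h0 x i (hl.2.2 x hx i (by omega)) hi
    -- A face `x i = 0` with `i < n` lacks the label `i + 1`, and a face `x i = N` lacks the label
    -- 0. Only the bottom face `x n = 0` contributes, and it is the box of dimension `n`.
    have hbd : boxEval N n (coboundary (boxPrism N n (fullLabel L (n + 1)))) = 0 := by
      refine boxEval_coboundary_eq_zero N n _ ?_ (by simp [boxPrism, prism])
      rintro i hi e (rfl | rfl) l _ hl <;> refine boxPrism_eq_zero hi (fun m _ hm => ?_) hl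
      · exact fullLabel_eq_zero (i + 1) (by omega) fun x hx => h0 x i (hm x hx)
      · exact fullLabel_eq_zero 0 (by omega) fun x hx => hN x i (by omega) (hm x hx)
    have htop : boxEval N n (fun l => fullLabel L (n + 1)
        (l.map fun a => Function.update a n N)) = 0 := by
      rw [← boxEval_zero N n]
      refine boxEval_congr fun l _ => fullLabel_eq_zero 0 (by omega) fun x hx => ?_
      obtain ⟨a, -, rfl⟩ := List.mem_map.mp hx
      exact hN _ n (by omega) (by simp)
    have hbot : boxEval N n (fun l => fullLabel L (n + 1)
        (l.map fun a => Function.update a n 0)) = boxEval N n (fullLabel L (n + 1)) := by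
      refine boxEval_congr fun l hl => ?_
      congr 1
      conv_rhs => rw [← List.map_id l]
      refine List.map_congr_left fun a ha => ?_
      rw [← hl.2.2 a ha n le_rfl, Function.update_eq_self, id]
    rw [hco, boxEval_coboundary_succ, hbd, htop, hbot, ih fun x i hi => hN x i (by omega)]
    rfl

/-- **Cubical Sperner lemma**. -/
theorem exists_full_cell (N : ℕ) (L : (ℕ → ℕ) → ℕ) (n : ℕ)
    (h0 : ∀ x i, x i = 0 → L x ≠ i + 1) (hN : ∀ x, ∀ i < n, x i = N → L x ≠ 0) :
    ∃ l : List (ℕ → ℕ), (∀ x ∈ l, ∀ y ∈ l, Adj x y) ∧ ∀ k ≤ n, ∃ x ∈ l, L x = k := by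
  obtain ⟨l, hl, hne⟩ := exists_cell_of_boxEval_ne_zero
    (by rw [boxEval_fullLabel N L n h0 hN]; exact one_ne_zero)
  refine ⟨l, hl.2.1, fun k hk => ?_⟩
  by_contra hcon
  push Not at hcon
  exact hne (fullLabel_eq_zero k (by omega) hcon)

/-- **The Hex theorem** in dimension `n`: if the lattice points are coloured with `n` colours, then
for some `i` there is a chain of adjacent points of colour `i` which joins the hyperplanes
`x i = 0` and `x i = N`. -/
theorem hex {n : ℕ} (N : ℕ) (c : (Fin n → ℕ) → Fin n) :
    ∃ i, ∃ x y : Fin n → ℕ, x i = 0 ∧ y i = N ∧ c x = i ∧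
      Relation.ReflTransGen (fun a b => c a = i ∧ c b = i ∧ Adj a b) x y := by
  classical
  by_contra hcon
  push Not at hcon
  -- A point is low if its own colour joins it to the zero face of that colour's direction.
  let low : (Fin n → ℕ) → Prop := fun y => ∃ x : Fin n → ℕ, x (c y) = 0 ∧ c x = c y ∧
    Relation.ReflTransGen (fun a b => c a = c y ∧ c b = c y ∧ Adj a b) x y
  have low_ne : ∀ y, low y → y (c y) ≠ N := fun y ⟨x, hx, hcx, hxy⟩ hyN =>
    hcon (c y) x y hx hyN hcx hxy
  have low_of_zero : ∀ y, y (c y) = 0 → low y := fun y hy => ⟨y, hy, rfl, .refl⟩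
  have low_adj : ∀ y z, low y → c z = c y → Adj y z → low z := by
    rintro y z ⟨x, hx, hcx, hxy⟩ hz hyz
    refine ⟨x, by rw [hz]; exact hx, hcx.trans hz.symm, ?_⟩
    rw [hz]
    exact hxy.tail ⟨rfl, hz, hyz⟩
  let res : (ℕ → ℕ) → (Fin n → ℕ) := fun x i => x i
  -- The box is enlarged to side `N + 1`, so that its outer layer can carry nonzero labels, as the
  -- Sperner condition at the upper faces demands.
  let L : (ℕ → ℕ) → ℕ := fun x =>
    if h : ∃ i : Fin n, N < x i then (h.choose : ℕ) + 1
    else if low (res x) then 0 else (c (res x) : ℕ) + 1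
  have hout : ∀ x, (∃ i : Fin n, N < x i) → ∃ i : Fin n, N < x i ∧ L x = i + 1 :=
    fun x h => ⟨h.choose, h.choose_spec, dif_pos h⟩
  have hlow : ∀ x, (¬ ∃ i : Fin n, N < x i) → low (res x) → L x = 0 := fun x h h' => by
    simp only [L, dif_neg h, if_pos h']
  have hhigh : ∀ x, (¬ ∃ i : Fin n, N < x i) → ¬ low (res x) → L x = c (res x) + 1 :=
    fun x h h' => by simp only [L, dif_neg h, if_neg h']
  obtain ⟨l, hadj, hfull⟩ := exists_full_cell (N + 1) L n
    (by
      intro x i hxi hL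
      by_cases ho : ∃ i : Fin n, N < x i
      · obtain ⟨j, hj, hLj⟩ := hout x ho
        have : i = j := by omega
        subst this
        omega
      · by_cases hlo : low (res x)
        · rw [hlow x ho hlo] at hL; omega
        · rw [hhigh x ho hlo] at hL
          have : (c (res x) : ℕ) = i := by omega
          exact hlo (low_of_zero _ (by simp only [res]; rw [this, hxi])))
    (by
      intro x i hi hxi hL
      obtain ⟨j, hj, hLj⟩ := hout x ⟨⟨i, hi⟩, by simp only [hxi]; omega⟩
      omega)
  obtain ⟨x, hx, hLx⟩ := hfull 0 (by omega)
  have hxin : ¬ ∃ i : Fin n, N < x i := fun h => by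
    obtain ⟨j, _, hj⟩ := hout x h; omega
  have hxlow : low (res x) := by
    by_contra h; rw [hhigh x hxin h] at hLx; omega
  -- The cell pairs a low point `x` with a neighbour `y` labelled by the colour of `x`. Either `y`
  -- lies in the outer layer and `x` has reached the far side, or `y` has the colour of `x` and so
  -- would be low.
  obtain ⟨y, hy, hLy⟩ := hfull (c (res x) + 1) (c (res x)).2
  have hxy : Adj (res x) (res y) := fun i => hadj x hx y hy i
  by_cases hyo : ∃ i : Fin n, N < y i
  · obtain ⟨j, hj, hLj⟩ := hout y hyo
    have : j = c (res x) := Fin.ext (by omega)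
    subst this
    have h1 : y (c (res x)) ≤ x (c (res x)) + 1 := (hxy (c (res x))).2
    have h2 : x (c (res x)) ≠ N := low_ne _ hxlow
    push Not at hxin
    have h3 := hxin (c (res x))
    omega
  · have hynl : ¬ low (res y) := fun h => by rw [hlow y hyo h] at hLy; omega
    rw [hhigh y hyo hynl] at hLy
    exact hynl (low_adj _ _ hxlow (Fin.ext (by omega)) hxy)

end CubicalSperner

/-! ### Algebra and topology of groupoids -/

namespace ArrowGroupoid

/-! ### Quotients of arrows, and paths in a generated subgroupoid -/

section Algebra

variable {G : Type*} [ArrowGroupoid G]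

theorem comp_congr {a a' b b' : G} (ha : a = a') (hb : b = b') (h : src a = rng b) :
    comp a b h = comp a' b' (by rw [← ha, ← hb]; exact h) := by
  subst ha hb; rfl

theorem comp_comp (a b c : G) (h : src a = rng b) (h' : src (comp a b h) = rng c) :
    comp (comp a b h) c h' = comp a (comp b c ((src_comp a b h).symm.trans h'))
      (h.trans (rng_comp _ _ _).symm) :=
  comp_assoc a b c h ((src_comp a b h).symm.trans h')

theorem comp_eq_of_rng {a b : G} (h : src a = rng b) (ha : a = rng b) : comp a b h = b := by
  rw [comp_congr ha rfl]; exact rng_mul b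

theorem comp_eq_of_src {a b : G} (h : src a = rng b) (hb : b = src a) : comp a b h = a := by
  rw [comp_congr rfl hb]; exact mul_src a

theorem inv_comp_cancel (a b : G) (h : src a = rng b) (h' : src (inv a) = rng (comp a b h)) :
    comp (inv a) (comp a b h) h' = b := by
  rw [← comp_assoc (inv a) a b (src_inv a) h]
  exact comp_eq_of_rng _ ((inv_mul a).trans h)

theorem comp_inv_cancel (a b : G) (h : src (inv a) = rng b)
    (h' : src a = rng (comp (inv a) b h)) : comp a (comp (inv a) b h) h' = b := by
  rw [← comp_assoc a (inv a) b (rng_inv a).symm h]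
  exact comp_eq_of_rng _ ((mul_inv a).trans ((src_inv a).symm.trans h))

theorem eq_inv_of_comp {a b : G} (h : src a = rng b) (hab : comp a b h = rng a) : b = inv a := by
  have h1 := inv_comp_cancel a b h ((src_inv a).trans (rng_comp a b h).symm)
  rw [← h1]
  exact comp_eq_of_src _ (hab.trans (src_inv a).symm)

theorem inv_inv (a : G) : inv (inv a) = a :=
  (eq_inv_of_comp (src_inv a) ((inv_mul a).trans (rng_inv a).symm)).symm

theorem inv_eq_self {u : G} (hu : u ∈ units G) : inv u = u := by
  have hu' : src u = u := hu
  have hr : rng u = u := by rw [← hu', rng_src]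
  exact (eq_inv_of_comp (hu'.trans hr.symm) (comp_eq_of_rng _ hr.symm |>.trans hr.symm)).symm

theorem rng_eq_self {u : G} (hu : u ∈ units G) : rng u = u := by
  have hu' : src u = u := hu
  rw [← hu', rng_src]

theorem inv_comp (a b : G) (h : src a = rng b) :
    inv (comp a b h) = comp (inv b) (inv a) (by rw [src_inv, rng_inv, h]) := by
  refine (eq_inv_of_comp (by rw [src_comp, rng_comp, rng_inv]) ?_).symm
  rw [comp_comp]
  have : comp b (comp (inv b) (inv a) (by rw [src_inv, rng_inv, h]))
      (by rw [rng_comp, rng_inv]) = inv a := comp_inv_cancel _ _ _ _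
  rw [comp_congr rfl this, mul_inv, rng_comp]

/-- The arrow `a⁻¹ b` for arrows `a` and `b` with the same range. -/
def ldiv (a b : G) (h : rng a = rng b) : G := comp (inv a) b ((src_inv a).trans h)

theorem src_ldiv (a b : G) (h : rng a = rng b) : src (ldiv a b h) = src b := src_comp _ _ _

theorem rng_ldiv (a b : G) (h : rng a = rng b) : rng (ldiv a b h) = src a :=
  (rng_comp _ _ _).trans (rng_inv a)

theorem ldiv_self (a : G) : ldiv a a rfl = src a := inv_mul a

theorem ldiv_congr {a a' b b' : G} (ha : a = a') (hb : b = b') (h : rng a = rng b) :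
    ldiv a b h = ldiv a' b' (by rw [← ha, ← hb]; exact h) := by
  subst ha hb; rfl

theorem inv_ldiv (a b : G) (h : rng a = rng b) : inv (ldiv a b h) = ldiv b a h.symm := by
  simp only [ldiv, inv_comp, inv_inv]

theorem ldiv_comp_ldiv (a b c : G) (h : rng a = rng b) (h' : rng b = rng c)
    (hs : src (ldiv a b h) = rng (ldiv b c h')) :
    comp (ldiv a b h) (ldiv b c h') hs = ldiv a c (h.trans h') := by
  simp only [ldiv, comp_comp, comp_inv_cancel]

theorem ldiv_comp_left (c a b : G) (h : rng a = rng b) (hc : src c = rng a) :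
    ldiv (comp c a hc) (comp c b (hc.trans h)) (by rw [rng_comp, rng_comp]) = ldiv a b h := by
  simp only [ldiv, inv_comp, comp_comp, inv_comp_cancel]

theorem ldiv_unit {u g : G} (hu : u ∈ units G) (h : rng u = rng g) : ldiv u g h = g :=
  comp_eq_of_rng _ ((inv_eq_self hu).trans ((rng_eq_self hu).symm.trans h))

/-- The set of products of composable pairs. -/
def mulSet (A B : Set G) : Set G := {g | ∃ a ∈ A, ∃ b ∈ B, ∃ h : src a = rng b, comp a b h = g}

/-- The step relation: `b = a k` for some `k ∈ K`. -/
def Step (K : Set G) (a b : G) : Prop := ∃ h : rng a = rng b, ldiv a b h ∈ K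

/-- The set of arrows which are products of elements of `K`. -/
def generated (K : Set G) : Set G := {g | Relation.ReflTransGen (Step K) (rng g) g}

theorem rng_eq_of_reflTransGen_step {K : Set G} {a b : G}
    (h : Relation.ReflTransGen (Step K) a b) : rng a = rng b := by
  induction h with
  | refl => rfl
  | tail _ h ih => exact ih.trans h.choose

theorem reflTransGen_step_comp {K : Set G} {a b : G} (h : Relation.ReflTransGen (Step K) a b)
    (c : G) (hc : src c = rng a) :
    Relation.ReflTransGen (Step K) (comp c a hc)
      (comp c b (hc.trans (rng_eq_of_reflTransGen_step h))) := by
  induction h with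
  | refl => exact .refl
  | tail h1 h2 ih =>
    refine ih.tail ?_
    obtain ⟨h, hk⟩ := h2
    exact ⟨by rw [rng_comp, rng_comp], by rwa [ldiv_comp_left c _ _ h]⟩

theorem subset_generated (K : Set G) : K ⊆ generated K := fun g hg =>
  .single ⟨rng_rng g, by rwa [ldiv_unit (src_rng g) (rng_rng g)]⟩

/-- Left translation preserves steps. Translating the path to `g` by its inverse and reversing it
gives the path to `inv g`; appending the `g`-translate of the path to `h` gives the path to the
product. -/
theorem isSubgroupoid_generated {K : Set G} (hK : ∀ g ∈ K, inv g ∈ K) :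
    IsSubgroupoid (generated K) where
  inv_mem g hg := by
    have : Std.Symm (Step K) := ⟨fun a b ⟨h, hk⟩ =>
      ⟨h.symm, by rw [← inv_ldiv a b h]; exact hK _ hk⟩⟩
    have h1 := reflTransGen_step_comp hg (inv g) ((src_inv g).trans (rng_rng g).symm)
    have h2 := (Relation.ReflTransGen.stdSymm (r := Step K)).symm _ _ h1
    change Relation.ReflTransGen (Step K) (rng (inv g)) (inv g)
    rw [rng_inv]
    rw [comp_eq_of_src (a := inv g) (b := rng g) _ (src_inv g).symm,
      inv_mul g] at h2
    exact h2
  comp_mem g hg h hh hgh := by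
    have h1 := reflTransGen_step_comp hh g (hgh.trans (rng_rng h).symm)
    rw [comp_eq_of_src (a := g) (b := rng h) _ hgh.symm] at h1
    change Relation.ReflTransGen (Step K) (rng (comp g h hgh)) (comp g h hgh)
    rw [rng_comp]
    exact Relation.ReflTransGen.trans hg h1

/-- Since units are in `K`, a path may rest at its end; this allows paths in different factors to
share a common length. -/
theorem exists_path {K : Set G} (hunits : units G ⊆ K) {a g : G}
    (hg : Relation.ReflTransGen (Step K) a g) :
    ∃ (m : ℕ) (p : ℕ → G), p 0 = a ∧ (∀ k, Step K (p k) (p (k + 1))) ∧ ∀ k, m ≤ k → p k = g := by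
  have hrefl : ∀ a : G, Step K a a := fun a => ⟨rfl, by
    rw [ldiv_self]; exact hunits (src_src a)⟩
  induction hg with
  | refl => exact ⟨0, fun _ => a, rfl, fun _ => hrefl a, fun _ _ => rfl⟩
  | @tail b c _ hbc ih =>
    obtain ⟨m, p, h0, hp, hm⟩ := ih
    refine ⟨m + 1, fun k => if k ≤ m then p k else c, by simp [h0], fun k => ?_, fun k hk => ?_⟩
    · by_cases h1 : k + 1 ≤ m
      · simp only [h1, show k ≤ m by omega, if_true]; exact hp k
      · by_cases h2 : k ≤ m
        · simp only [h1, h2, if_true, if_false]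
          rw [hm k (by omega)]; exact hbc
        · simp only [h1, h2, if_false]; exact hrefl c
    · simp only [show ¬ k ≤ m by omega, if_false]

end Algebra

/-! ### Compactness, openness of the units, and the values of the dimension -/

section Topology

variable {G : Type*} [TopologicalSpace G] [ArrowGroupoid G]

theorem continuous_src [IsTopologicalGroupoid G] : Continuous (src : G → G) := by
  have h : (src : G → G) = (fun p : {p : G × G // src p.1 = rng p.2} => comp p.1.1 p.1.2 p.2) ∘
      fun g => ⟨(inv g, g), src_inv g⟩ := funext fun g => (inv_mul g).symm
  rw [h]
  refine IsTopologicalGroupoid.continuous_comp.comp (Continuous.subtype_mk ?_ _)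
  exact IsTopologicalGroupoid.continuous_inv.prodMk continuous_id

theorem continuous_rng [IsTopologicalGroupoid G] : Continuous (rng : G → G) := by
  have h : (rng : G → G) = src ∘ inv := funext fun g => (src_inv g).symm
  rw [h]
  exact continuous_src.comp IsTopologicalGroupoid.continuous_inv

theorem continuous_srcMap [IsTopologicalGroupoid G] : Continuous (srcMap : G → units G) :=
  continuous_src.subtype_mk _

theorem continuous_rngMap [IsTopologicalGroupoid G] : Continuous (rngMap : G → units G) :=
  continuous_rng.subtype_mk _

theorem isOpen_inv_image [IsTopologicalGroupoid G] {K : Set G} (hK : IsOpen K) :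
    IsOpen (inv '' K) := by
  have : inv '' K = inv ⁻¹' K :=
    congrFun (Set.image_eq_preimage_of_inverse inv_inv inv_inv) K
  rw [this]
  exact hK.preimage IsTopologicalGroupoid.continuous_inv

theorem isCompact_mulSet [IsTopologicalGroupoid G] [T2Space G] {A B : Set G} (hA : IsCompact A)
    (hB : IsCompact B) : IsCompact (mulSet A B) := by
  have hcl : IsClosed {p : G × G | src p.1 = rng p.2} :=
    isClosed_eq (continuous_src.comp continuous_fst) (continuous_rng.comp continuous_snd)
  have h1 : IsCompact (Subtype.val ⁻¹' (A ×ˢ B) : Set {p : G × G // src p.1 = rng p.2}) :=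
    hcl.isClosedEmbedding_subtypeVal.isCompact_preimage (hA.prod hB)
  have h2 := h1.image (IsTopologicalGroupoid.continuous_comp (G := G))
  convert h2 using 1
  ext g
  constructor
  · rintro ⟨a, ha, b, hb, h, rfl⟩
    exact ⟨⟨(a, b), h⟩, ⟨ha, hb⟩, rfl⟩
  · rintro ⟨⟨⟨a, b⟩, h⟩, ⟨ha, hb⟩, rfl⟩
    exact ⟨a, ha, b, hb, h, rfl⟩

/-- The source map is injective near a unit, and nearby `g` and `src g` have the same source, so
they coincide. -/
theorem isOpen_units [IsTopologicalGroupoid G] (het : IsEtale G) : IsOpen (units G) := by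
  rw [isOpen_iff_mem_nhds]
  intro u hu
  have hu' : src u = u := hu
  obtain ⟨e, hue, he⟩ := het.src_isLocalHomeomorph u
  have h1 : e.source ∈ nhds u := e.open_source.mem_nhds hue
  have h2 : src ⁻¹' e.source ∈ nhds u :=
    continuous_src.continuousAt.preimage_mem_nhds (by rwa [hu'])
  filter_upwards [h1, h2] with g hg hg'
  refine e.injOn hg' hg ?_
  rw [← he]
  exact Subtype.ext (src_src g)

theorem not_hasDadAtMost_zero (h : 1 ≤ dad G) : ¬ HasDadAtMost G 0 := fun h0 => by
  have : dad G ≤ ((0 : ℕ) : ℕ∞) := iInf₂_le 0 h0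
  have := h.trans this
  simp at this

theorem HasDadAtMost.mono {d d' : ℕ} (hdd : d ≤ d') (h : HasDadAtMost G d) :
    HasDadAtMost G d' := by
  intro K hK hKc
  obtain ⟨U, hU, hcov, hH⟩ := h K hK hKc
  refine ⟨fun i => U ⟨min i d, by omega⟩, fun i => hU _, hcov.trans ?_, fun i => hH _⟩
  refine Set.iUnion_subset fun i => ?_
  refine Set.subset_iUnion_of_subset ⟨i, by omega⟩ ?_
  have : (⟨min (i : ℕ) d, by omega⟩ : Fin (d + 1)) = i := Fin.ext (by simp; omega)
  simp only [this]
  exact subset_rfl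

theorem hasDadAtMost_of_dad_le {d : ℕ} (h : dad G ≤ d) : HasDadAtMost G d := by
  by_contra hcon
  have h1 : ((d + 1 : ℕ) : ℕ∞) ≤ dad G := by
    refine le_iInf₂ fun d' hd' => ?_
    by_contra hlt
    exact hcon (hd'.mono (by have := Nat.cast_lt.mp (not_le.mp hlt); omega))
  have := Nat.cast_le.mp (h1.trans h)
  omega

theorem dad_le_of_hasDadAtMost {d : ℕ} (h : HasDadAtMost G d) : dad G ≤ d := iInf₂_le d h

/-- If the dynamic asymptotic dimension is positive, then some symmetric relatively compact open
neighbourhood of the unit space generates a groupoid which is not relatively compact. -/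
theorem exists_generating [IsTopologicalGroupoid G] [T2Space G] (het : IsEtale G)
    (hc : IsCompact (units G)) (h : ¬ HasDadAtMost G 0) :
    ∃ K : Set G, IsOpen K ∧ IsCompact (closure K) ∧ units G ⊆ K ∧ (∀ g ∈ K, inv g ∈ K) ∧
      ∀ C, IsCompact C → ¬ generated K ⊆ C := by
  unfold HasDadAtMost at h
  push Not at h
  obtain ⟨K, hK, hKc, hne⟩ := h
  have hinv : Continuous (inv : G → G) := IsTopologicalGroupoid.continuous_inv
  refine ⟨K ∪ inv '' K ∪ units G, (hK.union (isOpen_inv_image hK)).union (isOpen_units het), ?_,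
    Set.subset_union_right, ?_, ?_⟩
  · refine ((hKc.union (hKc.image hinv)).union hc).closure_of_subset ?_
    gcongr <;> exact subset_closure
  · rintro g ((hg | ⟨k, hk, rfl⟩) | hg)
    · exact Or.inl (Or.inr ⟨g, hg, rfl⟩)
    · rw [inv_inv]; exact Or.inl (Or.inl hk)
    · rw [inv_eq_self hg]; exact Or.inr hg
  · intro C hC hsub
    -- With a single open set the whole unit space is allowed, so no relatively compact subgroupoid
    -- can contain `K`.
    obtain ⟨i, hi⟩ := hne (fun _ => Set.univ) (fun _ => isOpen_univ)
      (fun _ _ => Set.mem_iUnion.mpr ⟨0, trivial⟩)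
    refine hi _ (isSubgroupoid_generated (K := K ∪ inv '' K ∪ units G) ?_)
      (hC.closure_of_subset hsub) ?_
    · rintro g ((hg | ⟨k, hk, rfl⟩) | hg)
      · exact Or.inl (Or.inr ⟨g, hg, rfl⟩)
      · rw [inv_inv]; exact Or.inl (Or.inl hk)
      · rw [inv_eq_self hg]; exact Or.inr hg
    · intro g hg
      exact subset_generated _ (Or.inl (Or.inl hg.1))

end Topology

end ArrowGroupoid

/-! ### The lower bound -/

namespace ArrowGroupoid

open CubicalSperner in
/-- A product of `n` groupoids of positive dynamic asymptotic dimension has dynamic asymptotic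
dimension at least `n`. -/
theorem le_of_hasDadAtMost_pi {n : ℕ} {G : Fin n → Type*}
    [∀ i, TopologicalSpace (G i)] [∀ i, ArrowGroupoid (G i)]
    [∀ i, IsTopologicalGroupoid (G i)] [∀ i, T2Space (G i)]
    (het : ∀ i, IsEtale (G i)) (hc : ∀ i, IsCompact (units (G i)))
    (hpos : ∀ i, ¬ HasDadAtMost (G i) 0) {d : ℕ} (hd : HasDadAtMost (∀ i, G i) d) : n ≤ d := by
  by_contra hlt
  have hdn : d + 1 ≤ n := by omega
  choose K hKo hKc hKu hKi hKg using fun i => exists_generating (het i) (hc i) (hpos i)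
  obtain ⟨U, -, hcov, hH⟩ := hd (Set.univ.pi K) (isOpen_set_pi Set.finite_univ fun i _ => hKo i)
    (by rw [closure_pi_set]; exact isCompact_univ_pi hKc)
  choose H hHs hHc hHK using hH
  have hfar : ∀ i, ∃ g ∈ generated (K i), ∀ j, g ∉ Function.eval i '' closure (H j) := by
    intro i
    have h1 := hKg i (⋃ j, Function.eval i '' closure (H j))
      (isCompact_iUnion fun j => (hHc j).image (continuous_apply i))
    obtain ⟨g, hg, hg'⟩ := Set.not_subset.mp h1
    exact ⟨g, hg, fun j hj => hg' (Set.mem_iUnion.mpr ⟨j, hj⟩)⟩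
  choose g hg hgfar using hfar
  choose m p hp0 hpstep hpm using fun i => exists_path (hKu i) (hg i)
  have hrng : ∀ i k, rng (p i k) = rng (g i) := by
    intro i k
    induction k with
    | zero => rw [hp0, rng_rng]
    | succ k ih => rw [← (hpstep i k).choose, ih]
  let N := Finset.univ.sup m
  have hpN : ∀ i, p i N = g i := fun i => hpm i N (Finset.le_sup (Finset.mem_univ i))
  have hnear : ∀ i (a b : ℕ), a ≤ b + 1 → b ≤ a + 1 →
      ldiv (p i a) (p i b) ((hrng i a).trans (hrng i b).symm) ∈ K i := by
    intro i a b hab hba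
    rcases lt_trichotomy a b with h | rfl | h
    · obtain rfl : b = a + 1 := by omega
      exact (hpstep i a).choose_spec
    · rw [ldiv_self]; exact hKu i (src_src _)
    · obtain rfl : a = b + 1 := by omega
      rw [← inv_ldiv _ _ ((hrng i b).trans (hrng i (b + 1)).symm)]
      exact hKi i _ (hpstep i b).choose_spec
  let P : (Fin n → ℕ) → ∀ i, G i := fun x i => p i (x i)
  have hPr : ∀ x y, rng (P x) = rng (P y) := fun x y =>
    funext fun i => (hrng i (x i)).trans (hrng i (y i)).symm
  have hPK : ∀ x y (h : Adj x y), ldiv (P x) (P y) (hPr x y) ∈ Set.univ.pi K :=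
    fun x y h i _ => hnear i _ _ (h i).1 (h i).2
  have hcol : ∀ x, ∃ j, srcMap (P x) ∈ U j := by
    intro x
    have h1 : srcMap (P x) ∈ srcMap '' Set.univ.pi K :=
      ⟨src (P x), fun i _ => hKu i (src_src _), Subtype.ext (src_src _)⟩
    exact Set.mem_iUnion.mp (hcov (Or.inl h1))
  choose c hcU using hcol
  -- Here `d < n` enters: the `d + 1` colours embed into the `n` directions.
  obtain ⟨i, x, y, hx, hy, hcx, hxy⟩ := hex N fun x => Fin.castLE hdn (c x)
  have hPH : ∀ z w, Adj z w → c z = c x → c w = c x →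
      ldiv (P z) (P w) (hPr z w) ∈ H (c x) := by
    intro z w hzw hz hw
    refine hHK (c x) ⟨hPK z w hzw, ?_, ?_⟩
    · have : srcMap (ldiv (P z) (P w) (hPr z w)) = srcMap (P w) := Subtype.ext (src_ldiv _ _ _)
      rw [this, ← hw]; exact hcU w
    · have : rngMap (ldiv (P z) (P w) (hPr z w)) = srcMap (P z) := Subtype.ext (rng_ldiv _ _ _)
      rw [this, ← hz]; exact hcU z
  have hchain : ldiv (P x) (P y) (hPr x y) ∈ H (c x) := by
    clear hy
    induction hxy with
    | refl => exact hPH x x (fun i => by omega) rfl rfl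
    | @tail z w _ hzw ih =>
      obtain ⟨h1, h2, h3⟩ := hzw
      have h4 := hPH z w h3 (Fin.castLE_injective hdn (h1.trans hcx.symm))
        (Fin.castLE_injective hdn (h2.trans hcx.symm))
      -- Quotients along the chain telescope: `(x⁻¹ z) (z⁻¹ w) = x⁻¹ w`.
      rw [← ldiv_comp_ldiv (P x) (P z) (P w) (hPr x z) (hPr z w)
        (by rw [src_ldiv, rng_ldiv])]
      exact (hHs _).comp_mem _ ih _ h4 _
  refine hgfar i (c x) ⟨_, subset_closure hchain, ?_⟩
  have hPx : P x i = rng (g i) := by simp only [P, hx, hp0]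
  have hPy : P y i = g i := by simp only [P, hy, hpN]
  have h1 : Function.eval i (ldiv (P x) (P y) (hPr x y)) =
      ldiv (P x i) (P y i) (congrFun (hPr x y) i) := rfl
  rw [h1, ldiv_congr hPx hPy]
  exact ldiv_unit (src_rng _) _

end ArrowGroupoid

/-! ### The upper bound -/

namespace ArrowGroupoid

theorem exists_isClopen_between {X : Type*} [TopologicalSpace X]
    (hX : TopologicalSpace.IsTopologicalBasis {s : Set X | IsClopen s}) {C O : Set X}
    (hC : IsCompact C) (hO : IsOpen O) (hCO : C ⊆ O) : ∃ V, IsClopen V ∧ C ⊆ V ∧ V ⊆ O := by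
  refine hC.induction_on (p := fun s => ∃ V, IsClopen V ∧ s ⊆ V ∧ V ⊆ O)
    ⟨∅, isClopen_empty, subset_rfl, Set.empty_subset _⟩
    (fun _ _ hst ⟨V, h1, h2, h3⟩ => ⟨V, h1, hst.trans h2, h3⟩)
    (fun _ _ ⟨V, h1, h2, h3⟩ ⟨W, h4, h5, h6⟩ =>
      ⟨V ∪ W, h1.union h4, Set.union_subset_union h2 h5, Set.union_subset h3 h6⟩) ?_
  intro x hx
  obtain ⟨V, hV, hxV, hVO⟩ := hX.exists_subset_of_mem_open (hCO hx) hO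
  exact ⟨V, mem_nhdsWithin_of_mem_nhds (hV.isOpen.mem_nhds hxV), V, hV, subset_rfl, hVO⟩

/-! ### Conjugating a subgroupoid by a choice of arrows -/

section Conjugation

variable {G : Type*} [ArrowGroupoid G]

/-- The arrow `a⁻¹ g b`. -/
def conj (a g b : G) (h : rng a = rng g) (h' : src g = rng b) : G :=
  ldiv a (comp g b h') (h.trans (rng_comp g b h').symm)

theorem conj_comp_conj {a g b h c : G} (h1 : rng a = rng g) (h2 : src g = rng b)
    (h3 : rng b = rng h) (h4 : src h = rng c)
    (hs : src (conj a g b h1 h2) = rng (conj b h c h3 h4)) :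
    comp (conj a g b h1 h2) (conj b h c h3 h4) hs =
      conj a (comp g h (h2.trans h3)) c (h1.trans (rng_comp _ _ _).symm)
        ((src_comp _ _ _).trans h4) := by
  simp only [conj, ldiv, comp_comp, comp_inv_cancel]

theorem inv_conj {a g b : G} (h1 : rng a = rng g) (h2 : src g = rng b) :
    inv (conj a g b h1 h2) = conj b (inv g) a (h2.symm.trans (rng_inv g).symm)
      ((src_inv g).trans h1.symm) := by
  simp only [conj, ldiv, comp_comp, inv_comp, inv_inv]

theorem src_conj {a g b : G} (h1 : rng a = rng g) (h2 : src g = rng b) :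
    src (conj a g b h1 h2) = src b := by rw [conj, src_ldiv, src_comp]

theorem rng_conj {a g b : G} (h1 : rng a = rng g) (h2 : src g = rng b) :
    rng (conj a g b h1 h2) = src a := by rw [conj, rng_ldiv]

theorem conj_congr {a a' g b b' : G} (ha : a = a') (hb : b = b') (h1 : rng a = rng g)
    (h2 : src g = rng b) : conj a g b h1 h2 = conj a' g b' (ha ▸ h1) (hb ▸ h2) := by
  subst ha hb; rfl

theorem mem_mulSet_of_conj_mem {A B : Set G} {a g b : G} (ha : a ∈ A) (hb : b ∈ A)
    (h1 : rng a = rng g) (h2 : src g = rng b) (h : conj a g b h1 h2 ∈ B) :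
    g ∈ mulSet A (mulSet B (inv '' A)) := by
  refine ⟨a, ha, comp (conj a g b h1 h2) (inv b) (by rw [src_conj, rng_inv]),
    ⟨_, h, inv b, ⟨b, hb, rfl⟩, _, rfl⟩, by rw [rng_comp, rng_conj], ?_⟩
  have h3 : comp b (inv b) (rng_inv b).symm = src g := (mul_inv b).trans h2.symm
  simp only [conj, ldiv, comp_comp, comp_inv_cancel]
  exact comp_eq_of_src _ h3

/-- The subgroupoid obtained from `H` by conjugating with the arrows `k x`. -/
def conjSubgroupoid (H : Set G) (V : Set (units G)) (k : units G → G)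
    (hkr : ∀ g, rng (k (rngMap g)) = rng g) (hks : ∀ g, src g = rng (k (srcMap g))) : Set G :=
  {g | rngMap g ∈ V ∧ srcMap g ∈ V ∧
    conj (k (rngMap g)) g (k (srcMap g)) (hkr g) (hks g) ∈ H}

theorem isSubgroupoid_conjSubgroupoid {H : Set G} (hH : IsSubgroupoid H) (V : Set (units G))
    (k : units G → G) (hkr : ∀ g, rng (k (rngMap g)) = rng g)
    (hks : ∀ g, src g = rng (k (srcMap g))) :
    IsSubgroupoid (conjSubgroupoid H V k hkr hks) where
  inv_mem g := by
    rintro ⟨h1, h2, h3⟩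
    have hr : rngMap (inv g) = srcMap g := Subtype.ext (rng_inv g)
    have hs : srcMap (inv g) = rngMap g := Subtype.ext (src_inv g)
    refine ⟨hr ▸ h2, hs ▸ h1, ?_⟩
    have h4 := hH.inv_mem _ h3
    rw [inv_conj] at h4
    rwa [conj_congr (congrArg k hr) (congrArg k hs)]
  comp_mem g := by
    rintro ⟨h1, h2, h3⟩ h ⟨h4, h5, h6⟩ hgh
    have hr : rngMap (comp g h hgh) = rngMap g := Subtype.ext (rng_comp g h hgh)
    have hs : srcMap (comp g h hgh) = srcMap h := Subtype.ext (src_comp g h hgh)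
    have he : rngMap h = srcMap g := Subtype.ext hgh.symm
    refine ⟨hr ▸ h1, hs ▸ h5, ?_⟩
    rw [conj_congr (congrArg k he) rfl] at h6
    have h7 := hH.comp_mem _ h3 _ h6 (by rw [src_conj, rng_conj])
    rw [conj_comp_conj] at h7
    rwa [conj_congr (congrArg k hr) (congrArg k hs)]

end Conjugation

variable {G : Type*} [TopologicalSpace G] [ArrowGroupoid G]

/-- The units of `U j` are joined by arrows of `K` only inside a relatively compact
subgroupoid. -/
def IsControlled (K : Set G) (U : Set (units G)) : Prop :=
  ∃ H : Set G, IsSubgroupoid H ∧ IsCompact (closure H) ∧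
    {g ∈ K | srcMap g ∈ U ∧ rngMap g ∈ U} ⊆ H

/-- The `K`-neighbourhood of a set of units. -/
def nbhd (K : Set G) (U : Set (units G)) : Set (units G) := rngMap '' {k ∈ K | srcMap k ∈ U}

/-- Choose for each `x ∈ V` an arrow `k x ∈ L` to `x` from a point of `U`. Conjugation by `k` takes
arrows of `K` over `V` into `L⁻¹ K L` over `U`, hence into `H`; the conjugated subgroupoid lies in
`L (closure H) L⁻¹`. Continuity of `k` is not needed. -/
theorem isControlled_of_subset_nbhd [IsTopologicalGroupoid G] [T2Space G] {K L : Set G}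
    (hL : IsCompact L) {U V : Set (units G)} (hV : V ⊆ nbhd L U)
    (hU : IsControlled (mulSet (inv '' L) (mulSet K L)) U) : IsControlled K V := by
  classical
  obtain ⟨H, hH, hHc, hHU⟩ := hU
  have hex : ∀ x : units G, ∃ k : G, rng k = x ∧ (x ∈ V → k ∈ L ∧ srcMap k ∈ U) := by
    intro x
    by_cases hx : x ∈ V
    · obtain ⟨k, hk, rfl⟩ := hV hx
      exact ⟨k, rfl, fun _ => hk⟩
    · exact ⟨x, rng_eq_self x.2, fun h => absurd h hx⟩
  choose k hk hkV using hex
  have hkr : ∀ g, rng (k (rngMap g)) = rng g := fun g => hk (rngMap g)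
  have hks : ∀ g, src g = rng (k (srcMap g)) := fun g => (hk (srcMap g)).symm
  refine ⟨conjSubgroupoid H V k hkr hks, isSubgroupoid_conjSubgroupoid hH V k hkr hks, ?_, ?_⟩
  · refine (isCompact_mulSet hL (isCompact_mulSet hHc
      (hL.image IsTopologicalGroupoid.continuous_inv))).closure_of_subset ?_
    rintro g ⟨h1, h2, h3⟩
    exact mem_mulSet_of_conj_mem (hkV _ h1).1 (hkV _ h2).1 _ _ (subset_closure h3)
  · rintro g ⟨hgK, h1, h2⟩
    refine ⟨h2, h1, hHU ⟨?_, ?_, ?_⟩⟩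
    · exact ⟨_, ⟨_, (hkV _ h2).1, rfl⟩, _, ⟨_, hgK, _, (hkV _ h1).1, _, rfl⟩, _, rfl⟩
    · have : srcMap (conj (k (rngMap g)) g (k (srcMap g)) (hkr g) (hks g)) =
        srcMap (k (srcMap g)) := Subtype.ext (src_conj _ _)
      rw [this]; exact (hkV _ h1).2
    · have : rngMap (conj (k (rngMap g)) g (k (srcMap g)) (hkr g) (hks g)) =
        srcMap (k (rngMap g)) := Subtype.ext (rng_conj _ _)
      rw [this]; exact (hkV _ h2).2

/-- A finite union of controlled sets between which there are no arrows in `K` is controlled. -/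
theorem isControlled_iUnion {ι : Type*} [Finite ι] {K : Set G} {T : ι → Set (units G)}
    (hT : ∀ i, IsControlled K (T i))
    (hdisj : ∀ i j x, x ∈ T i → x ∈ T j → i = j)
    (hsep : ∀ g ∈ K, ∀ i j, srcMap g ∈ T i → rngMap g ∈ T j → i = j) :
    IsControlled K (⋃ i, T i) := by
  choose H hH hHc hHT using hT
  -- Restricting each `H i` to arrows over `T i` prevents composition across different pieces.
  refine ⟨⋃ i, {g ∈ H i | srcMap g ∈ T i ∧ rngMap g ∈ T i}, ⟨?_, ?_⟩, ?_, ?_⟩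
  · intro g hg
    obtain ⟨i, h1, h2, h3⟩ := Set.mem_iUnion.mp hg
    have hr : rngMap (inv g) = srcMap g := Subtype.ext (rng_inv g)
    have hs : srcMap (inv g) = rngMap g := Subtype.ext (src_inv g)
    exact Set.mem_iUnion.mpr ⟨i, (hH i).inv_mem g h1, hs ▸ h3, hr ▸ h2⟩
  · intro g hg h hh hgh
    obtain ⟨i, h1, h2, h3⟩ := Set.mem_iUnion.mp hg
    obtain ⟨j, h4, h5, h6⟩ := Set.mem_iUnion.mp hh
    have he : srcMap g = rngMap h := Subtype.ext hgh
    obtain rfl := hdisj i j _ h2 (he ▸ h6)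
    have hr : rngMap (comp g h hgh) = rngMap g := Subtype.ext (rng_comp g h hgh)
    have hs : srcMap (comp g h hgh) = srcMap h := Subtype.ext (src_comp g h hgh)
    exact Set.mem_iUnion.mpr ⟨i, (hH i).comp_mem g h1 h h4 hgh, hs ▸ h5, hr ▸ h3⟩
  · rw [closure_iUnion_of_finite]
    exact isCompact_iUnion fun i => (hHc i).of_isClosed_subset isClosed_closure
      (closure_mono fun g hg => hg.1)
  · rintro g ⟨hgK, h1, h2⟩
    obtain ⟨i, hi⟩ := Set.mem_iUnion.mp h1
    obtain ⟨j, hj⟩ := Set.mem_iUnion.mp h2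
    obtain rfl := hsep g hgK i j hi hj
    exact Set.mem_iUnion.mpr ⟨i, hHT i ⟨hgK, hi, hj⟩, hi, hj⟩

theorem IsControlled.mono {K K' : Set G} {U U' : Set (units G)} (h : IsControlled K U)
    (hK : K' ⊆ K) (hU : U' ⊆ U) : IsControlled K' U' := by
  obtain ⟨H, h1, h2, h3⟩ := h
  exact ⟨H, h1, h2, fun g hg => h3 ⟨hK hg.1, hU hg.2.1, hU hg.2.2⟩⟩

/-- If the dynamic asymptotic dimension is at most `1`, then for every `m` and at every scale there
are `m + 2` controlled clopen sets such that every unit is missed by at most one of them. -/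
theorem exists_clopen_family [IsTopologicalGroupoid G] [T2Space G] [LocallyCompactSpace G]
    (het : IsEtale G) (hc : IsCompact (units G))
    (hzero : TopologicalSpace.IsTopologicalBasis {s : Set (units G) | IsClopen s})
    (hdad : HasDadAtMost G 1) (m : ℕ) {K : Set G} (hK : IsCompact K) :
    ∃ U : Fin (m + 2) → Set (units G), (∀ j, IsClopen (U j)) ∧
      (∀ x i j, x ∉ U i → x ∉ U j → i = j) ∧ ∀ j, IsControlled K (U j) := by
  have : CompactSpace (units G) := isCompact_iff_compactSpace.mp hc
  induction m generalizing K with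
  | zero =>
    obtain ⟨O, hO, hKO, hOc⟩ := exists_isOpen_superset_and_isCompact_closure (hK.union hc)
    obtain ⟨U, hU, hcov, hH⟩ := hdad O hO hOc
    have hcov' : ∀ x, x ∈ U 0 ∨ x ∈ U 1 := by
      intro x
      have h1 : x ∈ srcMap '' O := ⟨x, hKO (Or.inr x.2), Subtype.ext x.2⟩
      simpa [Fin.exists_fin_two] using hcov (Or.inl h1)
    obtain ⟨V, hV, h0, h1⟩ := exists_isClopen_between hzero (hU 1).isClosed_compl.isCompact (hU 0)
      fun x hx => (hcov' x).resolve_right hx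
    have hsub : K ⊆ O := fun g hg => hKO (Or.inl hg)
    refine ⟨![V, Vᶜ], ?_, ?_, ?_⟩
    · simp [Fin.forall_fin_two, hV, hV.compl]
    · intro x i j
      fin_cases i <;> fin_cases j <;> simp
    · rw [Fin.forall_fin_two]
      exact ⟨IsControlled.mono (hH 0) hsub h1,
        IsControlled.mono (hH 1) hsub fun x hx => by
          by_contra h; exact hx (h0 h)⟩
  | succ m ih =>
    obtain ⟨O, hO, hKO, hOc⟩ := exists_isOpen_superset_and_isCompact_closure (hK.union hc)
    have hinv : Continuous (inv : G → G) := IsTopologicalGroupoid.continuous_inv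
    have hKL : IsCompact (mulSet (inv '' closure O) (mulSet K (closure O))) :=
      isCompact_mulSet (hOc.image hinv) (isCompact_mulSet hK hOc)
    -- The enlarged scale controls the thickened sets `V j`; the scale `K` itself serves the
    -- additional set.
    obtain ⟨U, hU, hmiss, hctl⟩ := ih (hKL.union hK)
    have hV : ∀ j, ∃ V, IsClopen V ∧ nbhd (K ∪ units G) (U j) ⊆ V ∧ V ⊆ nbhd O (U j) := by
      intro j
      refine exists_isClopen_between hzero ?_ ?_ ?_
      · exact ((hK.union hc).inter_right ((hU j).isClosed.preimage continuous_srcMap)).image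
          continuous_rngMap
      · exact het.rng_isLocalHomeomorph.isOpenMap _
          (hO.inter ((hU j).isOpen.preimage continuous_srcMap))
      · exact Set.image_mono fun g hg => ⟨hKO hg.1, hg.2⟩
    choose V hVc hUV hVO using hV
    have hUV' : ∀ j, U j ⊆ V j := fun j x hx => hUV j
      ⟨x, ⟨Or.inr x.2, by rwa [show srcMap (x : G) = x from Subtype.ext x.2]⟩,
        Subtype.ext (rng_eq_self x.2)⟩
    have hmem : ∀ x i j, x ∉ V j → i ≠ j → x ∈ U i := fun x i j hj hij => by
      by_contra hi
      exact hij (hmiss x i j hi fun h => hj (hUV' j h))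
    have hVmiss : ∀ x i j, x ∉ V i → x ∉ V j → i = j := fun x i j hi hj =>
      hmiss x i j (fun h => hi (hUV' i h)) fun h => hj (hUV' j h)
    -- The additional set consists of the points missed by some `V j`, so a point outside it is
    -- missed by no `V j`.
    refine ⟨Fin.snoc (α := fun _ => Set (units G)) V (⋃ j, (V j)ᶜ), ?_, ?_, ?_⟩
    · intro j
      refine Fin.lastCases ?_ (fun j => ?_) j
      · simpa using isClopen_iUnion_of_finite fun j => (hVc j).compl
      · simpa using hVc j
    · intro x i j
      refine Fin.lastCases ?_ (fun i => ?_) i <;> refine Fin.lastCases ?_ (fun j => ?_) j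
      · simp
      · simp only [Fin.snoc_last, Fin.snoc_castSucc]
        exact fun h h' => absurd (Set.mem_iUnion.mpr ⟨j, h'⟩) h
      · simp only [Fin.snoc_last, Fin.snoc_castSucc]
        exact fun h' h => absurd (Set.mem_iUnion.mpr ⟨i, h'⟩) h
      · simp only [Fin.snoc_castSucc]
        exact fun h h' => congrArg _ (hVmiss x i j h h')
    · intro j
      refine Fin.lastCases ?_ (fun j => ?_) j
      · simp only [Fin.snoc_last]
        refine isControlled_iUnion (fun j => ?_) (fun i j x hi hj => hVmiss x i j hi hj) ?_
        · obtain ⟨i, hi⟩ := exists_ne j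
          exact (hctl i).mono Set.subset_union_right fun x hx => hmem x i j hx hi
        · intro g hg i j hi hj
          by_contra hij
          -- A source outside `V i` lies in `U j`, so an arrow of `K` carries it into `V j`.
          exact hj (hUV j ⟨g, ⟨Or.inl hg, hmem _ j i hi (Ne.symm hij)⟩, rfl⟩)
      · simp only [Fin.snoc_castSucc]
        refine isControlled_of_subset_nbhd hOc ((hVO j).trans
          (Set.image_mono fun g hg => ⟨subset_closure hg.1, hg.2⟩))
          ((hctl j).mono Set.subset_union_left subset_rfl)

theorem isSubgroupoid_pi {ι : Type*} {G : ι → Type*} [∀ i, ArrowGroupoid (G i)]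
    {H : ∀ i, Set (G i)} (hH : ∀ i, IsSubgroupoid (H i)) : IsSubgroupoid (Set.univ.pi H) where
  inv_mem _ hg i _ := (hH i).inv_mem _ (hg i trivial)
  comp_mem _ hg _ hh hgh i _ :=
    (hH i).comp_mem _ (hg i trivial) _ (hh i trivial) (congrFun hgh i)

/-- A product of `n` groupoids of dynamic asymptotic dimension at most `1` has dynamic asymptotic
dimension at most `n`. -/
theorem hasDadAtMost_pi {n : ℕ} {G : Fin n → Type*}
    [∀ i, TopologicalSpace (G i)] [∀ i, ArrowGroupoid (G i)]
    [∀ i, IsTopologicalGroupoid (G i)] [∀ i, T2Space (G i)] [∀ i, LocallyCompactSpace (G i)]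
    (het : ∀ i, IsEtale (G i)) (hc : ∀ i, IsCompact (units (G i)))
    (hzero : ∀ i, TopologicalSpace.IsTopologicalBasis {s : Set (units (G i)) | IsClopen s})
    (hdad : ∀ i, HasDadAtMost (G i) 1) : HasDadAtMost (∀ i, G i) n := by
  intro K _ hKc
  have hfam : ∀ i, ∃ U : Fin (n + 1) → Set (units (G i)), (∀ j, IsClopen (U j)) ∧
      (∀ x j k, x ∉ U j → x ∉ U k → j = k) ∧
      ∀ j, IsControlled (Function.eval i '' closure K) (U j) := by
    intro i
    obtain ⟨m, rfl⟩ := Nat.exists_eq_succ_of_ne_zero i.pos.ne'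
    exact exists_clopen_family (het i) (hc i) (hzero i) (hdad i) m
      (hKc.image (continuous_apply i))
  choose U hU hmiss hctl using hfam
  choose H hHs hHc hHU using hctl
  let pr : ∀ i, units (∀ i, G i) → units (G i) := fun i x => ⟨x.1 i, congrFun x.2 i⟩
  have hpr : ∀ i, Continuous (pr i) := fun i =>
    ((continuous_apply i).comp continuous_subtype_val).subtype_mk _
  refine ⟨fun j => ⋂ i, pr i ⁻¹' U i j, fun j =>
    isOpen_iInter_of_finite fun i => (hU i j).isOpen.preimage (hpr i), ?_, fun j =>
    ⟨Set.univ.pi fun i => H i j, isSubgroupoid_pi fun i => hHs i j, ?_, ?_⟩⟩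
  · intro x _
    by_contra hx
    simp only [Set.mem_iUnion, Set.mem_iInter, not_exists, not_forall, Set.mem_preimage] at hx
    -- An uncovered `x` assigns to each of the `n + 1` indices a coordinate where it fails; no
    -- coordinate fails twice, contradicting the pigeonhole principle.
    choose f hf using hx
    have hinj : Function.Injective f := fun j k hjk =>
      hmiss (f j) (pr (f j) x) j k (hf j) (by rw [hjk]; exact hf k)
    have := Fintype.card_le_of_injective f hinj
    simp at this
  · rw [closure_pi_set]
    exact isCompact_univ_pi fun i => hHc i j
  · rintro g ⟨hgK, h1, h2⟩ i _
    exact hHU i j ⟨⟨g, subset_closure hgK, rfl⟩, Set.mem_iInter.mp h1 i, Set.mem_iInter.mp h2 i⟩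

end ArrowGroupoid

theorem theorem3p1 (n : ℕ) (G : Fin n → Type*)
    [∀ i, TopologicalSpace (G i)] [∀ i, ArrowGroupoid (G i)]
    [∀ i, ArrowGroupoid.IsTopologicalGroupoid (G i)]
    [∀ i, SecondCountableTopology (G i)] [∀ i, LocallyCompactSpace (G i)] [∀ i, T2Space (G i)]
    (hprincipal : ∀ i, ArrowGroupoid.IsPrincipal (G i))
    (hetale : ∀ i, ArrowGroupoid.IsEtale (G i))
    (hcompact : ∀ i, IsCompact (ArrowGroupoid.units (G i)))
    (hzero : ∀ i, TopologicalSpace.IsTopologicalBasis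
      {s : Set (ArrowGroupoid.units (G i)) | IsClopen s})
    (hdad : ∀ i, 1 ≤ ArrowGroupoid.dad (G i)) :
    (n : ℕ∞) ≤ ArrowGroupoid.dad (∀ i, G i) ∧
      ((∀ i, ArrowGroupoid.dad (G i) = 1) → ArrowGroupoid.dad (∀ i, G i) = (n : ℕ∞)) := by
  constructor
  · refine le_iInf₂ fun d hd => Nat.cast_le.mpr ?_
    exact ArrowGroupoid.le_of_hasDadAtMost_pi hetale hcompact
      (fun i => ArrowGroupoid.not_hasDadAtMost_zero (hdad i)) hd
  · intro h1
    refine le_antisymm ?_ ?_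
    · exact ArrowGroupoid.dad_le_of_hasDadAtMost (ArrowGroupoid.hasDadAtMost_pi hetale hcompact
        hzero fun i => ArrowGroupoid.hasDadAtMost_of_dad_le (by rw [h1 i]; rfl))
    · refine le_iInf₂ fun d hd => Nat.cast_le.mpr ?_
      exact ArrowGroupoid.le_of_hasDadAtMost_pi hetale hcompact
        (fun i => ArrowGroupoid.not_hasDadAtMost_zero (hdad i)) hd
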